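/- Let $n\ge 1$, let $\delta_{n-1}=(n-1,n-2,\dots,1)$ be the staircase partition (empty if $n=1$), and let $\mu=(\mu_1\ge\cdots\ge\mu_n\ge 0)$ be a partition, padded with zeros to length $n$, whose Ferrers diagram is contained in that of $\delta_{n-1}$. A filling of the cells of $\mu$ by nonnegative integers is called reverse flagged if its entries decrease strictly from left to right along rows, decrease weakly down columns, and the entries in row $i$ all lie between $1$ and $n-i$. Let $r^{(n)}_\mu$ be the number of reverse flagged fillings of shape $\mu$, and let $|\mu|=\mu_1+\cdots+\mu_n$. Then $$ r^{(n)}_\mu=\det\left(\binom{n-i}{\mu_j-j+i}\right)_{1\le i,j\le n}=\frac{2^{|\mu|}}{2^{\binom n2}}\cdot\det\left(\binom{2n-2i}{\mu_j+n-j}\right)_{1\le i,j\le n}, $$ where $\binom{m}{k}=0$ if $k<0$ or $k>m$. -/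

import Mathlib

/-- The staircase partition `δ_k = (k, k - 1, …, 1)`. With rows and columns indexed from `0`, row `i`
consists of the cells `(i, j)` with `j < k - i`. -/
def staircase (k : ℕ) : YoungDiagram where
  cells := (Finset.range k ×ˢ Finset.range k).filter fun c => c.1 + c.2 < k
  isLowerSet := by
    rintro ⟨a, b⟩ ⟨c, d⟩ h hab
    obtain ⟨h1, h2⟩ := Prod.mk_le_mk.mp h
    simp only [Finset.coe_filter, Finset.mem_product, Finset.mem_range, Set.mem_ofPred_eq] at hab ⊢
    omega

theorem mem_staircase {k i j : ℕ} : (i, j) ∈ staircase k ↔ i + j < k := by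
  rw [← YoungDiagram.mem_cells]
  simp only [staircase, Finset.mem_filter, Finset.mem_product, Finset.mem_range]
  omega

/-- The row lengths of `δ_k` are `k, k - 1, …, 1, 0, 0, …`. -/
theorem rowLen_staircase (k i : ℕ) : (staircase k).rowLen i = k - i := by
  have h : ∀ j, j < (staircase k).rowLen i ↔ j < k - i := fun j => by
    rw [← YoungDiagram.mem_iff_lt_rowLen, mem_staircase]
    omega
  have h1 := h ((staircase k).rowLen i)
  have h2 := h (k - i)
  omega

/-- A filling `T : μ → ℕ` of the cells of `μ` is reverse flagged (with respect to `n`) if its entries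
decrease strictly from left to right along rows, decrease weakly down columns, and the entries of
the `i`-th row (`i = 1, 2, …`) lie between `1` and `n - i`. A cell `c` is `(row, column)`, both
counted from `0`, so `c` lies in the row with number `i = c.1 + 1`. -/
structure IsReverseFlagged (n : ℕ) (μ : YoungDiagram) (T : {c : ℕ × ℕ // c ∈ μ} → ℕ) : Prop where
  row_strict : ∀ c d : {c : ℕ × ℕ // c ∈ μ}, c.1.1 = d.1.1 → c.1.2 < d.1.2 → T d < T c
  col_weak : ∀ c d : {c : ℕ × ℕ // c ∈ μ}, c.1.2 = d.1.2 → c.1.1 < d.1.1 → T d ≤ T c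
  one_le : ∀ c, 1 ≤ T c
  le_flag : ∀ c, T c ≤ n - (c.1.1 + 1)

/-- There are only finitely many reverse flagged fillings, so counting them makes sense. -/
theorem finite_setOf_isReverseFlagged (n : ℕ) (μ : YoungDiagram) :
    {T : {c : ℕ × ℕ // c ∈ μ} → ℕ | IsReverseFlagged n μ T}.Finite := by
  have : Finite {c : ℕ × ℕ // c ∈ μ} := Finite.of_injective
    (fun c => (⟨c.1, c.2⟩ : μ.cells)) fun _ _ h => Subtype.ext (congrArg (fun x => x.1) h)
  refine (Set.Finite.pi' (t := fun _ => Set.Iic n) fun _ => Set.finite_Iic n).subset ?_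
  intro T hT c
  exact (hT.le_flag c).trans (Nat.sub_le _ _)

/-- The number `r^{(n)}_μ` of reverse flagged fillings of shape `μ`. -/
noncomputable def numReverseFlagged (n : ℕ) (μ : YoungDiagram) : ℕ :=
  {T : {c : ℕ × ℕ // c ∈ μ} → ℕ | IsReverseFlagged n μ T}.ncard

/-- The binomial coefficient `m.choose k` for an integer `k`; it is `0` for negative `k`. -/
def binomInt (m : ℕ) (k : ℤ) : ℕ := if 0 ≤ k then m.choose k.toNat else 0

/-! The count and the first determinant obey the same recursion in `n`. Subtracting 1 from every
entry of a filling erases its 1s; by strictness each row has at most one, at its end. What remains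
is a filling for `n - 1`, with the rows in some set `s` shortened by one (`extendedFillingEquiv`).
On the determinant side, when the last part is 0, the last row is `(0, …, 0, 1)`, and Pascal's rule
splits each column of the remaining minor in two; multilinearity gives a sum over the same sets `s`
(`det_flagMatrix_succ`). Sets `s` that do not leave a partition contribute 0
(`det_flagMatrix_eq_zero`). The second matrix is, up to powers of 2 in rows and columns, a
unitriangular matrix times the first. -/

/-! ### Comparison of the two determinants -/

open Matrix Finset in
/-- Expanding `(1 + x) ^ (2 p) = ((2 + x) x + 1) ^ p` and comparing coefficients. -/
theorem choose_two_mul_eq_sum (p k : ℕ) :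
    ((2 * p).choose k : ℚ) =
      ∑ q ∈ range (p + 1), (p.choose q : ℚ) * (4 ^ q * binomInt q ((k : ℤ) - q) * (1 / 2 ^ k)) := by
  have key : ((Polynomial.X + Polynomial.C 1 : Polynomial ℚ) ^ (2 * p)) =
      ∑ q ∈ range (p + 1), (Polynomial.X + Polynomial.C 2) ^ q * Polynomial.X ^ q *
        Polynomial.C (p.choose q : ℚ) := by
    have h : (Polynomial.X + Polynomial.C 1 : Polynomial ℚ) ^ 2 =
        (Polynomial.X + Polynomial.C 2) * Polynomial.X + 1 := by
      have : (Polynomial.C 2 : Polynomial ℚ) = 2 := rfl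
      rw [Polynomial.C_1, this]
      ring
    rw [pow_mul, h, add_pow]
    refine sum_congr rfl fun q _ => ?_
    rw [one_pow, mul_one, mul_pow, Polynomial.C_eq_natCast]
  have h := congrArg (fun f => Polynomial.coeff f k) key
  simp only [Polynomial.finsetSum_coeff, Polynomial.coeff_mul_C, Polynomial.coeff_mul_X_pow',
    Polynomial.coeff_X_add_C_pow, one_pow, one_mul] at h
  rw [h]
  refine sum_congr rfl fun q _ => ?_
  by_cases hq : q ≤ k
  · obtain ⟨l, rfl⟩ := Nat.exists_eq_add_of_le hq
    have h1 : binomInt q (((q + l : ℕ) : ℤ) - q) = q.choose l := by simp [binomInt]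
    rw [if_pos hq, h1, Nat.add_sub_cancel_left]
    -- The power of 2 coming from `(X + 2) ^ q` is `2 ^ (q - l) = 4 ^ q / 2 ^ (q + l)`, so it
    -- separates into row and column factors.
    by_cases hl : l ≤ q
    · obtain ⟨r, rfl⟩ := Nat.exists_eq_add_of_le hl
      rw [Nat.add_sub_cancel_left]
      have : (4 : ℚ) = 2 ^ 2 := by norm_num
      rw [this, ← pow_mul]
      field_simp
      ring
    · rw [Nat.choose_eq_zero_of_lt (not_le.mp hl)]
      simp
  · have h1 : binomInt q ((k : ℤ) - q) = 0 := by
      rw [binomInt, if_neg (by omega)]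
    rw [if_neg hq, h1]
    simp

/-- The matrix of binomial coefficients attached to an integer sequence `a`. -/
def flagMatrix (n : ℕ) (a : ℕ → ℤ) : Matrix (Fin n) (Fin n) ℤ :=
  Matrix.of fun i j : Fin n =>
    (binomInt (n - ((i : ℕ) + 1)) (a j - (((j : ℕ) : ℤ) + 1) + (((i : ℕ) : ℤ) + 1)) : ℤ)

theorem sum_fin_sub_succ (n : ℕ) : ∑ i : Fin n, (n - ((i : ℕ) + 1)) = n.choose 2 := by
  rw [Fin.sum_univ_eq_sum_range (fun i => n - (i + 1)), Nat.choose_two_right, ← Finset.sum_range_id,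
    ← Finset.sum_range_reflect (fun i => i)]
  exact Finset.sum_congr rfl fun i _ => by omega

-- `choose_two_mul_eq_sum` is a matrix product. The row factors contribute `4 ^ n.choose 2`, the
-- column factors `1 / 2 ^ (∑ a j + n.choose 2)`.
open Matrix Finset in
theorem det_choose_two_mul (n : ℕ) (a : ℕ → ℕ) :
    (((Matrix.of fun i j : Fin n =>
      ((2 * n - 2 * ((i : ℕ) + 1)).choose (a j + (n - ((j : ℕ) + 1))) : ℤ)).det : ℤ) : ℚ) *
        2 ^ (∑ j : Fin n, a j) = 2 ^ n.choose 2 * ((flagMatrix n fun i => a i).det : ℚ) := by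
  set U : Matrix (Fin n) (Fin n) ℚ :=
    Matrix.of fun i l => ((n - ((i : ℕ) + 1)).choose (n - ((l : ℕ) + 1)) : ℚ) with hU
  have hU1 : U.det = 1 := by
    rw [det_of_isUpperTriangular]
    · simp [hU]
    · intro i j hij
      have hij' : (j : ℕ) < i := hij
      simp only [hU, of_apply, Nat.cast_eq_zero]
      exact Nat.choose_eq_zero_of_lt (by omega)
  have hE : ((Matrix.of fun i j : Fin n =>
      ((2 * n - 2 * ((i : ℕ) + 1)).choose (a j + (n - ((j : ℕ) + 1))) : ℤ)).map
        (Int.castRingHom ℚ)) =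
      U * (of fun i j : Fin n => (1 / 2 ^ (a j + (n - ((j : ℕ) + 1)))) *
        (of fun i j : Fin n => (4 ^ (n - ((i : ℕ) + 1))) *
          ((flagMatrix n fun i => a i).map (Int.castRingHom ℚ)) i j) i j) := by
    ext i j
    rw [mul_apply]
    simp only [map_apply, of_apply, hU, flagMatrix, Int.coe_castRingHom, Int.cast_natCast]
    have e : 2 * n - 2 * ((i : ℕ) + 1) = 2 * (n - ((i : ℕ) + 1)) := by omega
    rw [e, choose_two_mul_eq_sum]
    have hsub : range (n - ((i : ℕ) + 1) + 1) ⊆ range n := by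
      intro x hx
      have := i.2
      simp only [mem_range] at hx ⊢
      omega
    -- Row `l` of the flag matrix corresponds to `q = n - (l + 1)`, hence the reflection.
    rw [sum_subset hsub, ← sum_range_reflect, sum_range]
    · refine sum_congr rfl fun l _ => ?_
      have e1 : n - 1 - (l : ℕ) = n - ((l : ℕ) + 1) := by omega
      have e2 : (((a j + (n - ((j : ℕ) + 1)) : ℕ) : ℤ) - (n - ((l : ℕ) + 1) : ℕ)) =
          (a j : ℤ) - (((j : ℕ) : ℤ) + 1) + (((l : ℕ) : ℤ) + 1) := by
        have := l.2
        have := j.2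
        omega
      rw [e1, e2]
      ring
    · intro x _ hx
      rw [Nat.choose_eq_zero_of_lt (by rw [mem_range] at hx; omega)]
      simp
  have h := congrArg det hE
  rw [det_mul, hU1, one_mul, det_mul_row, det_mul_column] at h
  rw [← eq_intCast (Int.castRingHom ℚ), ← eq_intCast (Int.castRingHom ℚ), RingHom.map_det,
    RingHom.map_det, RingHom.mapMatrix_apply, RingHom.mapMatrix_apply, h, prod_pow_eq_pow_sum, sum_fin_sub_succ]
  have h2 : ∏ j : Fin n, (1 / 2 ^ (a j + (n - ((j : ℕ) + 1))) : ℚ) =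
      1 / (2 ^ (∑ j : Fin n, a j) * 2 ^ n.choose 2) := by
    rw [prod_div_distrib, prod_const_one, prod_pow_eq_pow_sum, sum_add_distrib, sum_fin_sub_succ,
      pow_add]
  have h4 : (4 : ℚ) = 2 * 2 := by norm_num
  rw [h2, h4, mul_pow]
  field_simp

/-! ### Recursion for the determinant -/

/-- Decrease `a` by one at the places in `s`. -/
noncomputable def decrease {m : ℕ} (a : ℕ → ℤ) (s : Finset (Fin m)) (i : ℕ) : ℤ :=
  open Classical in a i - if ∃ x ∈ s, (x : ℕ) = i then 1 else 0

theorem decrease_of_mem {m : ℕ} (a : ℕ → ℤ) {s : Finset (Fin m)} {x : Fin m} (h : x ∈ s) :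
    decrease a s x = a x - 1 := by
  rw [decrease, if_pos ⟨x, h, rfl⟩]

theorem decrease_of_notMem {m : ℕ} (a : ℕ → ℤ) {s : Finset (Fin m)} {x : Fin m} (h : x ∉ s) :
    decrease a s x = a x := by
  rw [decrease, if_neg, sub_zero]
  rintro ⟨y, hy, hyx⟩
  exact h (Fin.ext hyx ▸ hy)

theorem decrease_of_le {m : ℕ} (a : ℕ → ℤ) (s : Finset (Fin m)) {i : ℕ} (h : m ≤ i) :
    decrease a s i = a i := by
  rw [decrease, if_neg, sub_zero]
  rintro ⟨y, -, hy⟩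
  have := y.2
  omega

theorem decrease_le {m : ℕ} (a : ℕ → ℤ) (s : Finset (Fin m)) (i : ℕ) : decrease a s i ≤ a i := by
  unfold decrease
  split_ifs <;> omega

theorem le_decrease {m : ℕ} (a : ℕ → ℤ) (s : Finset (Fin m)) (i : ℕ) :
    a i - 1 ≤ decrease a s i := by
  unfold decrease
  split_ifs <;> omega

theorem binomInt_succ (m : ℕ) (k : ℤ) :
    binomInt (m + 1) k = binomInt m k + binomInt m (k - 1) := by
  unfold binomInt
  rcases lt_trichotomy k 0 with h | rfl | h
  · rw [if_neg (by omega), if_neg (by omega), if_neg (by omega)]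
  · simp
  · obtain ⟨l, rfl⟩ : ∃ l : ℕ, k = l + 1 := ⟨(k - 1).toNat, by omega⟩
    rw [if_pos (by omega), if_pos (by omega), if_pos (by omega)]
    have h1 : ((l : ℤ) + 1).toNat = l + 1 := by omega
    have h2 : ((l : ℤ) + 1 - 1).toNat = l := by omega
    rw [h1, h2, Nat.choose_succ_succ, add_comm]

theorem binomInt_zero_left {k : ℤ} (h : k ≠ 0) : binomInt 0 k = 0 := by
  unfold binomInt
  split_ifs with hk
  · exact Nat.choose_eq_zero_of_lt (by omega)
  · rfl

theorem det_flagMatrix_eq_zero_of_pos {m : ℕ} {a : ℕ → ℤ} (ha : Antitone a) (h : 0 < a m) :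
    (flagMatrix (m + 1) a).det = 0 := by
  refine Matrix.det_eq_zero_of_row_eq_zero (Fin.last m) fun j => ?_
  have hj : (j : ℕ) ≤ m := by have := j.2; omega
  have := ha hj
  simp only [flagMatrix, Matrix.of_apply, Fin.val_last, Nat.sub_self]
  rw [binomInt_zero_left (by omega)]
  rfl

/-- An ascent at `i` forces the new values to differ by exactly 1, so columns `i` and `i + 1`
coincide. If `i + 1 = m`, the last part has become `-1` and its column vanishes. -/
theorem det_flagMatrix_eq_zero {m : ℕ} {a : ℕ → ℤ} (ha : Antitone a) (h0 : a m = 0)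
    (s : Finset (Fin m)) (hs : ¬ Antitone (decrease a s)) :
    (flagMatrix m (decrease a s)).det = 0 := by
  obtain ⟨i, hi⟩ : ∃ i, decrease a s i < decrease a s (i + 1) := by
    by_contra! h
    exact hs (antitone_nat_of_succ_le h)
  have h1 := ha (Nat.le_succ i)
  have h2 := le_decrease a s i
  have h3 := decrease_le a s (i + 1)
  rcases lt_trichotomy (i + 1) m with him | him | him
  · refine Matrix.det_zero_of_column_eq (i := ⟨i, by omega⟩) (j := ⟨i + 1, him⟩) (by simp) ?_
    intro k
    simp only [flagMatrix, Matrix.of_apply]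
    congr 2
    push_cast
    simp only [Nat.succ_eq_add_one] at h1
    omega
  · refine Matrix.det_eq_zero_of_column_eq_zero ⟨i, by omega⟩ fun k => ?_
    have := k.2
    simp only [flagMatrix, Matrix.of_apply]
    rw [him, h0] at h3
    rw [binomInt, if_neg]
    · rfl
    · rw [him] at hi
      omega
  · rw [decrease_of_le a s (by omega), decrease_of_le a s (by omega)] at hi
    simp only [Nat.succ_eq_add_one] at h1
    omega

theorem det_flagMatrix_succ {m : ℕ} {a : ℕ → ℤ} (ha : Antitone a) (h0 : a m = 0) :
    (flagMatrix (m + 1) a).det = ∑ s : Finset (Fin m), (flagMatrix m (decrease a s)).det := by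
  set A : Matrix (Fin m) (Fin m) ℤ :=
    (flagMatrix (m + 1) a).submatrix Fin.castSucc Fin.castSucc with hA
  have hdet : (flagMatrix (m + 1) a).det = A.det := by
    rw [Matrix.det_succ_row _ (Fin.last m), Fin.sum_univ_castSucc, Finset.sum_eq_zero, zero_add]
    · have h1 : flagMatrix (m + 1) a (Fin.last m) (Fin.last m) = 1 := by
        simp [flagMatrix, h0, binomInt]
      rw [h1, Fin.succAbove_last]
      simp [hA, ← two_mul]
    · intro j _
      have h1 : flagMatrix (m + 1) a (Fin.last m) j.castSucc = 0 := by
        have := j.2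
        have := ha this.le
        simp only [flagMatrix, Matrix.of_apply, Fin.val_last, Nat.sub_self, Fin.val_castSucc]
        rw [binomInt_zero_left (by omega)]
        rfl
      rw [h1]
      simp
  rw [hdet, ← Matrix.det_transpose]
  set B : Matrix (Fin m) (Fin m) ℤ := Matrix.of fun j i =>
    (binomInt (m - ((i : ℕ) + 1)) (a j - 1 - (((j : ℕ) : ℤ) + 1) + (((i : ℕ) : ℤ) + 1)) : ℤ)
  have hadd : A.transpose = B + (flagMatrix m a).transpose := by
    ext j i
    have e : m + 1 - ((i : ℕ) + 1) = m - ((i : ℕ) + 1) + 1 := by have := i.2; omega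
    simp only [hA, Matrix.transpose_apply, Matrix.submatrix_apply, flagMatrix, Matrix.of_apply,
      Fin.val_castSucc, Matrix.add_apply, B]
    rw [e, binomInt_succ, add_comm]
    push_cast
    congr 3
    ring
  have hml := (Matrix.detRowAlternating (n := Fin m) (R := ℤ)).toMultilinearMap.map_add_univ B
    (flagMatrix m a).transpose
  rw [hadd]
  refine hml.trans (Finset.sum_congr rfl fun s _ => ?_)
  rw [← Matrix.det_transpose (flagMatrix m (decrease a s))]
  refine congrArg Matrix.det ?_
  ext j i
  by_cases hj : j ∈ s
  · refine (congrFun (Finset.piecewise_eq_of_mem s (π := fun _ => Fin m → ℤ) _ _ hj) i).trans ?_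
    simp only [B, Matrix.transpose_apply, flagMatrix, Matrix.of_apply, decrease_of_mem a hj]
  · refine (congrFun (Finset.piecewise_eq_of_notMem s (π := fun _ => Fin m → ℤ) _ _ hj) i).trans ?_
    simp only [Matrix.transpose_apply, flagMatrix, Matrix.of_apply, decrease_of_notMem a hj]

/-! ### Recursion for the fillings -/

/-- A reverse flagged filling of the shape with row lengths `a`, extended by zero to all of
`ℕ × ℕ`. -/
structure IsExtendedFilling (n : ℕ) (a : ℕ → ℤ) (T : ℕ → ℕ → ℕ) : Prop where
  nonneg : ∀ i, 0 ≤ a i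
  pos_iff : ∀ i j, 0 < T i j ↔ (j : ℤ) < a i
  row : ∀ i j j', j < j' → T i j' ≤ T i j - 1
  col : ∀ i i' j, i ≤ i' → T i' j ≤ T i j
  flag : ∀ i j, T i j ≤ n - (i + 1)

theorem IsExtendedFilling.antitone {n : ℕ} {a : ℕ → ℤ} {T : ℕ → ℕ → ℕ}
    (hT : IsExtendedFilling n a T) : Antitone a := by
  intro i i' h
  by_contra! hlt
  have h0 := hT.nonneg i
  have hc := hT.col i i' (a i).toNat h
  have h1 := (hT.pos_iff i' (a i).toNat).2 (by omega)
  have h2 := (hT.pos_iff i (a i).toNat).1 (by omega)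
  omega

theorem IsExtendedFilling.add_column_strip {m : ℕ} {a : ℕ → ℤ} (ha : Antitone a)
    (h0 : ∀ i, m ≤ i → a i = 0) {s : Finset (Fin m)} {T : ℕ → ℕ → ℕ}
    (hT : IsExtendedFilling m (decrease a s) T) :
    IsExtendedFilling (m + 1) a fun i j => T i j + if (j : ℤ) < a i then 1 else 0 := by
  refine ⟨fun i => (hT.nonneg i).trans (decrease_le a s i), fun i j => ?_, fun i j j' h => ?_,
    fun i i' j h => ?_, fun i j => ?_⟩
  · have h1 := hT.pos_iff i j
    have h2 := decrease_le a s i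
    split_ifs with h <;> omega
  · have h1 := hT.pos_iff i j
    have h2 := hT.pos_iff i j'
    have h3 := le_decrease a s i
    have h4 := decrease_le a s i
    have h5 := hT.row i j j' h
    split_ifs <;> omega
  · have h1 := hT.col i i' j h
    have h2 := ha h
    split_ifs <;> omega
  · have h1 := hT.flag i j
    by_cases hi : m ≤ i
    · rw [if_neg (by rw [h0 i hi]; omega)]
      omega
    · split_ifs <;> omega

theorem IsExtendedFilling.sub_one {m : ℕ} {a : ℕ → ℤ} (h0 : ∀ i, m ≤ i → a i = 0)
    {T : ℕ → ℕ → ℕ} (hT : IsExtendedFilling (m + 1) a T) :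
    ∃ s : Finset (Fin m), IsExtendedFilling m (decrease a s) fun i j => T i j - 1 := by
  classical
  refine ⟨Finset.univ.filter fun i => ∃ j, T i j = 1, ?_⟩
  set s : Finset (Fin m) := Finset.univ.filter fun i => ∃ j, T i j = 1 with hs
  have hpos : ∀ i j, 0 < T i j - 1 ↔ (j : ℤ) < decrease a s i := by
    intro i j
    by_cases hi : i < m
    · by_cases hx : ∃ j, T i j = 1
      · have := decrease_of_mem a (s := s) (x := ⟨i, hi⟩) (by simpa [hs] using hx)
        simp only at this
        rw [this]
        -- The 1 sits in the last cell of its row: `a i = j₀ + 1`.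
        obtain ⟨j₀, hj₀⟩ := hx
        have h1 := hT.pos_iff i j
        have h2 := hT.pos_iff i j₀
        have h3 := hT.pos_iff i (j₀ + 1)
        have h4 := hT.row i j₀ (j₀ + 1) (by omega)
        rcases lt_trichotomy j j₀ with h | rfl | h
        · have := hT.row i j j₀ h
          omega
        · omega
        · omega
      · have := decrease_of_notMem a (s := s) (x := ⟨i, hi⟩) (by simpa [hs] using hx)
        simp only at this
        rw [this, ← hT.pos_iff i j]
        have : T i j ≠ 1 := fun h => hx ⟨j, h⟩
        omega
    · rw [decrease_of_le a s (by omega), ← hT.pos_iff i j]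
      have h1 := hT.pos_iff i j
      rw [h0 i (by omega)] at h1
      omega
  refine ⟨fun i => ?_, hpos, fun i j j' h => ?_, fun i i' j h => ?_, fun i j => ?_⟩
  · by_cases hi : i < m
    · by_cases hx : ∃ j, T i j = 1
      · have := decrease_of_mem a (s := s) (x := ⟨i, hi⟩) (by simpa [hs] using hx)
        simp only at this
        rw [this]
        obtain ⟨j₀, hj₀⟩ := hx
        have h2 := hT.pos_iff i j₀
        omega
      · have := decrease_of_notMem a (s := s) (x := ⟨i, hi⟩) (by simpa [hs] using hx)
        simp only at this
        rw [this]
        exact hT.nonneg i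
    · rw [decrease_of_le a s (by omega)]
      exact hT.nonneg i
  · have := hT.row i j j' h
    omega
  · have := hT.col i i' j h
    omega
  · have := hT.flag i j
    omega

/-- Extended fillings, sorted by the rows that contain a `1`. -/
noncomputable def extendedFillingEquiv {m : ℕ} {a : ℕ → ℤ} (ha : Antitone a)
    (h0 : ∀ i, m ≤ i → a i = 0) :
    (Σ s : Finset (Fin m), {T // IsExtendedFilling m (decrease a s) T}) ≃
      {T // IsExtendedFilling (m + 1) a T} := by
  refine Equiv.ofBijective (fun x => ⟨_, x.2.2.add_column_strip ha h0⟩) ⟨?_, ?_⟩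
  · rintro ⟨s, T, hT⟩ ⟨s', T', hT'⟩ h
    have hTT : T = T' := by
      funext i j
      have := congrFun (congrFun (congrArg Subtype.val h) i) j
      dsimp only at this
      omega
    subst hTT
    -- A filling determines its row lengths because `nonneg` excludes negative ones; these determine
    -- `s`.
    have hss : s = s' := by
      ext x
      have hd : decrease a s x = decrease a s' x := by
        have h1 := hT.nonneg x
        have h2 := hT'.nonneg x
        have h3 := (hT.pos_iff x (decrease a s' x).toNat).symm.trans (hT'.pos_iff x _)
        have h4 := (hT.pos_iff x (decrease a s x).toNat).symm.trans (hT'.pos_iff x _)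
        omega
      by_cases hx : x ∈ s <;> by_cases hx' : x ∈ s' <;> simp only [hx, hx']
      · rw [decrease_of_mem a hx, decrease_of_notMem a hx'] at hd
        omega
      · rw [decrease_of_notMem a hx, decrease_of_mem a hx'] at hd
        omega
    subst hss
    rfl
  · rintro ⟨T, hT⟩
    obtain ⟨s, hs⟩ := hT.sub_one h0
    refine ⟨⟨s, _, hs⟩, Subtype.ext ?_⟩
    funext i j
    have := hT.pos_iff i j
    dsimp only
    split_ifs <;> omega

/-- Containment in the staircase is not assumed, since shortening rows need not preserve it as `n`
drops. If the last part is positive, both sides are 0. -/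
theorem card_isExtendedFilling (n : ℕ) : ∀ a : ℕ → ℤ, Antitone a → (∀ i, n ≤ i → a i = 0) →
    Finite {T // IsExtendedFilling n a T} ∧
      (Nat.card {T // IsExtendedFilling n a T} : ℤ) = (flagMatrix n a).det := by
  induction n with
  | zero =>
    intro a ha h0
    have h0 : ∀ i, a i = 0 := fun i => h0 i (Nat.zero_le i)
    have hT : IsExtendedFilling 0 a fun _ _ => 0 :=
      ⟨fun i => (h0 i).ge, fun i j => by rw [h0 i]; omega, by simp, by simp, by simp⟩
    let u : Unique {T // IsExtendedFilling 0 a T} :=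
      ⟨⟨⟨_, hT⟩⟩, fun T => Subtype.ext (by
        funext i j
        exact Nat.le_zero.1 ((T.2.flag i j).trans (by omega)))⟩
    exact ⟨inferInstance, by simp⟩
  | succ m ih =>
    intro a ha h0
    rcases (((h0 (m + 1) le_rfl).ge.trans (ha m.le_succ)) : 0 ≤ a m).eq_or_lt with hm | hm
    · have h0' : ∀ i, m ≤ i → a i = 0 := by
        intro i hi
        rcases hi.eq_or_lt with rfl | hi
        · exact hm.symm
        · exact h0 i hi
      have hs : ∀ s : Finset (Fin m), Finite {T // IsExtendedFilling m (decrease a s) T} ∧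
          (Nat.card {T // IsExtendedFilling m (decrease a s) T} : ℤ) =
            (flagMatrix m (decrease a s)).det := by
        intro s
        by_cases has : Antitone (decrease a s)
        · exact ih _ has fun i hi => by rw [decrease_of_le a s hi, h0' i hi]
        · have : IsEmpty {T // IsExtendedFilling m (decrease a s) T} :=
            ⟨fun T => has T.2.antitone⟩
          exact ⟨inferInstance, by rw [det_flagMatrix_eq_zero ha hm.symm s has]; simp⟩
      have hfin := fun s => (hs s).1
      refine ⟨Finite.of_equiv _ (extendedFillingEquiv ha h0'), ?_⟩
      rw [← Nat.card_congr (extendedFillingEquiv ha h0'), Nat.card_sigma,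
        det_flagMatrix_succ ha hm.symm, Nat.cast_sum]
      exact Finset.sum_congr rfl fun s _ => (hs s).2
    · have : IsEmpty {T // IsExtendedFilling (m + 1) a T} := ⟨fun T => by
        have h1 := T.2.flag m 0
        have h2 := (T.2.pos_iff m 0).2 (by simpa using hm)
        omega⟩
      exact ⟨inferInstance, by rw [det_flagMatrix_eq_zero_of_pos ha hm]; simp⟩

/-- Extension by zero identifies reverse flagged fillings with extended fillings. -/
noncomputable def reverseFlaggedEquiv (n : ℕ) (μ : YoungDiagram) :
    {T : {c : ℕ × ℕ // c ∈ μ} → ℕ | IsReverseFlagged n μ T} ≃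
      {T // IsExtendedFilling n (fun i => (μ.rowLen i : ℤ)) T} where
  toFun T := ⟨fun i j => open Classical in if h : (i, j) ∈ μ then T.1 ⟨(i, j), h⟩ else 0, by
    obtain ⟨T, hT⟩ := T
    refine ⟨fun i => by positivity, fun i j => ?_, fun i j j' h => ?_, fun i i' j h => ?_,
      fun i j => ?_⟩
    · rw [Nat.cast_lt, ← YoungDiagram.mem_iff_lt_rowLen]
      split_ifs with hc
      · exact iff_of_true (hT.one_le _) hc
      · exact iff_of_false (lt_irrefl 0) hc
    · dsimp only
      split_ifs with h1 h2 h2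
      · exact Nat.le_sub_one_of_lt (hT.row_strict _ _ rfl h)
      · exact absurd (μ.up_left_mem le_rfl h.le h1) h2
      · exact Nat.zero_le _
      · exact Nat.zero_le _
    · dsimp only
      split_ifs with h1 h2 h2
      · rcases h.eq_or_lt with rfl | h
        · exact le_rfl
        · exact hT.col_weak _ _ rfl h
      · exact absurd (μ.up_left_mem h le_rfl h1) h2
      · exact Nat.zero_le _
      · exact Nat.zero_le _
    · dsimp only
      split_ifs with h1
      · exact hT.le_flag _
      · exact Nat.zero_le _⟩
  invFun T := ⟨fun c => T.1 c.1.1 c.1.2, by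
    obtain ⟨T, hT⟩ := T
    have hpos : ∀ c : {c : ℕ × ℕ // c ∈ μ}, 0 < T c.1.1 c.1.2 := fun c =>
      (hT.pos_iff _ _).2 (by exact_mod_cast YoungDiagram.mem_iff_lt_rowLen.1 c.2)
    refine ⟨fun c d h1 h2 => ?_, fun c d h1 h2 => ?_, hpos, fun c => hT.flag _ _⟩
    · have h3 := hT.row c.1.1 _ _ h2
      have h4 := hpos c
      dsimp only
      rw [← h1]
      omega
    · have h3 := hT.col _ _ c.1.2 h2.le
      dsimp only
      rw [← h1]
      exact h3⟩
  left_inv T := Subtype.ext (funext fun c => dif_pos c.2)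
  right_inv T := by
    refine Subtype.ext (funext fun i => funext fun j => ?_)
    dsimp only
    split_ifs with h
    · rfl
    · by_contra h1
      refine h (YoungDiagram.mem_iff_lt_rowLen.2 ?_)
      exact_mod_cast (T.2.pos_iff i j).1 (by omega)

theorem YoungDiagram.card_eq_sum_rowLen (μ : YoungDiagram) {n : ℕ} (h : μ.rowLen n = 0) :
    μ.card = ∑ j : Fin n, μ.rowLen j := by
  rw [Fin.sum_univ_eq_sum_range (fun j => μ.rowLen j), YoungDiagram.card,
    Finset.card_eq_sum_card_fiberwise (f := Prod.fst) (t := Finset.range n)]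
  · exact Finset.sum_congr rfl fun j _ => (μ.rowLen_eq_card).symm
  · rintro ⟨i, j⟩ hc
    have h1 : j < μ.rowLen i := YoungDiagram.mem_iff_lt_rowLen.1 hc
    simp only [Finset.coe_range, Set.mem_Iio]
    by_contra! hi
    have := μ.rowLen_anti n i hi
    omega

/-- Rows of `μ` and matrix indices are counted from `0` in the code: `i : Fin n` stands for `i + 1`,
and the part `μ_{j+1}` is `μ.rowLen j`. -/
theorem corollary4p3 (n : ℕ) (hn : 1 ≤ n) (μ : YoungDiagram) (hμ : μ ≤ staircase (n - 1)) :
    ((numReverseFlagged n μ : ℤ) =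
      (Matrix.of fun i j : Fin n =>
        (binomInt (n - ((i : ℕ) + 1))
          ((μ.rowLen j : ℤ) - (((j : ℕ) : ℤ) + 1) + (((i : ℕ) : ℤ) + 1)) : ℤ)).det) ∧
    ((numReverseFlagged n μ : ℚ) =
      (2 : ℚ) ^ μ.card / (2 : ℚ) ^ (n.choose 2) *
        (((Matrix.of fun i j : Fin n =>
          ((2 * n - 2 * ((i : ℕ) + 1)).choose (μ.rowLen j + (n - ((j : ℕ) + 1))) : ℤ)).det : ℤ) :
            ℚ)) := by
  have hrow : ∀ i, n - 1 ≤ i → μ.rowLen i = 0 := by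
    intro i hi
    by_contra h
    have h1 := hμ (YoungDiagram.mem_iff_lt_rowLen.2 (Nat.pos_of_ne_zero h))
    have h2 := mem_staircase.1 h1
    omega
  have h1 : (numReverseFlagged n μ : ℤ) = (flagMatrix n fun i => (μ.rowLen i : ℤ)).det := by
    rw [numReverseFlagged, ← Nat.card_coe_set_eq, Nat.card_congr (reverseFlaggedEquiv n μ)]
    refine (card_isExtendedFilling n _ (fun i j h => ?_) fun i hi => ?_).2
    · exact_mod_cast μ.rowLen_anti i j h
    · exact_mod_cast hrow i (by omega)
  refine ⟨h1, ?_⟩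
  have h2 := det_choose_two_mul n μ.rowLen
  rw [← μ.card_eq_sum_rowLen (hrow n (by omega)), ← h1, Int.cast_natCast] at h2
  rw [div_mul_eq_mul_div, eq_div_iff (by positivity), mul_comm, ← h2, mul_comm]
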